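/- Let $\lambda$ be a limit ordinal and let $j\colon (V_\lambda,\in)\to(V_\lambda,\in)$ be an elementary embedding that is not the identity. For $f\colon V_\lambda\to V_\lambda$ and $A\subseteq V_\lambda$ write $f\cdot A=\bigcup_{\alpha<\lambda}f(A\cap V_\alpha)$. Assume that $j$ is $\Sigma^1_1$-elementary, i.e. for every formula $\varphi$ of the form $\exists X_1\cdots\exists X_q\,\psi$, where the $X_i$ are second-order variables (ranging over subsets of $V_\lambda$) and $\psi$ is a formula in the language $\{\in\}$ without second-order quantifiers, and for all $x_1,\dots,x_m\in V_\lambda$ and $A_1,\dots,A_p\subseteq V_\lambda$, $$V_\lambda\models\varphi[x_1,\dots,x_m,A_1,\dots,A_p]\iff V_\lambda\models\varphi[j(x_1),\dots,j(x_m),j\cdot A_1,\dots,j\cdot A_p].$$ Let $\kappa_0$ be the critical point of $j$ (the least ordinal $\kappa<\lambda$ with $\kappa<j(\kappa)$) and $\kappa_{i+1}=j(\kappa_i)$. Let $j^{(0)}=j$ and let $j^{(i+1)}=j^{(i)}j^{(i)}$ be the function whose graph, as a set of ordered pairs, is $j^{(i)}\cdot(\text{graph of }j^{(i)})$. Let $$k=j\circ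 j^{(1)}\circ j^{(2)}\circ\cdots\colon V_\lambda\to V_\lambda$$ be the function with $k(a)=(j^{(0)}\circ j^{(1)}\circ\cdots\circ j^{(N)})(a)$ for any $N$ such that $j^{(m)}(a)=a$ for all $m>N$. Then these objects are well defined: the sequence $\langle\kappa_i\mid i<\omega\rangle$ exists and is a strictly increasing sequence of ordinals below $\lambda$, every $j^{(i)}\cdot(\text{graph of }j^{(i)})$ is the graph of a function from $V_\lambda$ to $V_\lambda$, and for every $a\in V_\lambda$ there is an $N$ as required. Moreover, for every $n<\omega$, $$[\kappa_{2n},\kappa_{2n+1})\cap\mathrm{Def}^{V_\lambda}(\mathrm{rng}\,k\cup V_{\kappa_{2n}})=\emptyset,$$ where $[\kappa_{2n},\kappa_{2n+1})$ is an interval of ordinals and $\mathrm{Def}^{V_\lambda}(A)$ is the set of all $b\in V_\lambda$ such that for some first-order formula $\varphi(x,y_1,\dots,y_m)$ in the language $\{\in\}$ and some $a_1,\dots,a_m\in A$, $b$ is the unique element of $V_\lambda$ with $V_\lambda\models\varphi[b,a_1,\dots,a_m]$. -/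

import Mathlib

open scoped FirstOrder ZFSet

universe u

noncomputable section

namespace RankToRank

/-! ### The structure `(V_λ, ∈)` -/

/-- The underlying set of `V_λ`, as a type. -/
abbrev VSet (lam : Ordinal.{u}) : Type (u + 1) := {x : ZFSet.{u} // x ∈ V_ lam}

/-- The only relation symbol of the language of set theory: binary membership. -/
inductive SetRel : ℕ → Type
  | mem : SetRel 2

/-- The language `{∈}` of set theory. -/
def setLang : FirstOrder.Language.{0, 0} := ⟨fun _ => Empty, SetRel⟩

/-- `V_λ` as a structure for the language of set theory. -/
instance setStructure (lam : Ordinal.{u}) : setLang.Structure (VSet lam) where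
  funMap := fun f _ => nomatch f
  RelMap := fun r xs =>
    match r, xs with
    | SetRel.mem, xs => (xs 0).1 ∈ (xs 1).1

/-- The (von Neumann) ordinal `α < λ` as an element of `V_λ`. -/
def ordV {lam : Ordinal.{u}} (α : Ordinal.{u}) (h : α < lam) : VSet lam :=
  ⟨α.toZFSet, ZFSet.mem_vonNeumann.2 (by rwa [Ordinal.rank_toZFSet])⟩

/-! ### Extension of `f : V_λ → V_λ` to subsets of `V_λ`, and application -/

/-- `A ∩ V_α`, as an element of `V_λ`, for `A ⊆ V_λ` and `α < λ`. -/
def cut {lam : Ordinal.{u}} (A : Set (VSet lam)) (α : Set.Iio lam) : VSet lam :=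
  ⟨ZFSet.sep (fun x => ∃ h : x ∈ V_ lam, (⟨x, h⟩ : VSet lam) ∈ A) (V_ α.1),
    ZFSet.mem_vonNeumann.2 ((ZFSet.subset_vonNeumann.1 ZFSet.sep_subset).trans_lt α.2)⟩

/-- `f · A = ⋃_{α < λ} f (A ∩ V_α)` for `A ⊆ V_λ`. -/
def extend {lam : Ordinal.{u}} (f : VSet lam → VSet lam) (A : Set (VSet lam)) :
    Set (VSet lam) :=
  ⋃ α : Set.Iio lam, {y | y.1 ∈ (f (cut A α)).1}

/-- A function `g : V_λ → V_λ` encoded as the set of pairs `⟨x, g x⟩` (a subset of `V_λ`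
when `λ` is a limit ordinal). -/
def graphOf {lam : Ordinal.{u}} (g : VSet lam → VSet lam) : Set (VSet lam) :=
  {p | ∃ x, p.1 = ZFSet.pair x.1 (g x).1}

/-- The application `f g` of `f` to `g`: the function whose graph is `f · (graph of g)`. -/
def app {lam : Ordinal.{u}} (f g : VSet lam → VSet lam) : VSet lam → VSet lam :=
  fun x => @Classical.epsilon _ ⟨x⟩
    (fun y => ∃ p ∈ extend f (graphOf g), p.1 = ZFSet.pair x.1 y.1)

/-- The right powers `j^(0) = j`, `j^(n+1) = j^(n) j^(n)`. -/
def rightPower {lam : Ordinal.{u}} (j : VSet lam → VSet lam) : ℕ → VSet lam → VSet lam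
  | 0 => j
  | n + 1 => app (rightPower j n) (rightPower j n)

/-! ### Inverse limits -/

/-- `k₀ ∘ k₁ ∘ ⋯ ∘ kₙ`. -/
def compUpTo {X : Type*} (k : ℕ → X → X) : ℕ → X → X
  | 0 => k 0
  | n + 1 => compUpTo k n ∘ k (n + 1)

open Classical in
/-- The inverse limit `k₀ ∘ k₁ ∘ k₂ ∘ ⋯`, sending `a` to `(k₀ ∘ ⋯ ∘ kₙ) a`, where `n` is
such that `k_m a = a` for every `m > n` (the value does not depend on which such `n` is
taken; a point without such an `n` is left alone). -/
def inverseLimit {X : Type*} (k : ℕ → X → X) (a : X) : X :=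
  if h : ∃ n, ∀ m > n, k m a = a then compUpTo k (Nat.find h) a else a

/-! ### Critical sequence -/

open Classical in
/-- The action of `f : V_λ → V_λ` on ordinals below `λ`. For `f` elementary, `f α` is an
ordinal, hence equal to its rank. -/
def onOrd {lam : Ordinal.{u}} (f : VSet lam → VSet lam) (α : Ordinal.{u}) : Ordinal.{u} :=
  if h : α < lam then (f (ordV α h)).1.rank else α

/-- The critical point: the least ordinal `κ < λ` with `κ < f κ`. -/
def crit {lam : Ordinal.{u}} (f : VSet lam → VSet lam) : Ordinal.{u} :=
  sInf {α | α < lam ∧ α < onOrd f α}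

/-- The critical sequence: `κ₀ = crit f` and `κ_{n+1} = f κ_n`. -/
def critSeq {lam : Ordinal.{u}} (f : VSet lam → VSet lam) : ℕ → Ordinal.{u}
  | 0 => crit f
  | n + 1 => onOrd f (critSeq f n)

/-! ### `Σ¹₁`-elementarity -/

/-- Second-order variables, as unary predicate symbols indexed by `ι`. -/
inductive VarRel (ι : Type) : ℕ → Type
  | var (i : ι) : VarRel ι 1

/-- The language with a unary predicate symbol for each second-order variable `i : ι`. -/
def varLang (ι : Type) : FirstOrder.Language.{0, 0} := ⟨fun _ => Empty, VarRel ι⟩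

/-- The interpretation of second-order variables by subsets of `M`. -/
@[reducible]
def varStructure {ι : Type} {M : Type*} (A : ι → Set M) : (varLang ι).Structure M where
  funMap := fun f _ => nomatch f
  RelMap := fun r xs =>
    match r, xs with
    | VarRel.var i, xs => xs 0 ∈ A i

/-- Satisfaction in `V_λ`, at the first-order assignment `v` and second-order assignment
`A`, of a formula in the language `{∈}` without second-order quantifiers, whose first-order
variables are indexed by `α` and whose second-order variables are indexed by `ι`. -/
def Sat {lam : Ordinal.{u}} {ι α : Type} (φ : (setLang.sum (varLang ι)).Formula α)
    (A : ι → Set (VSet lam)) (v : α → VSet lam) : Prop :=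
  letI := varStructure A
  φ.Realize v

/-- Satisfaction in `V_λ` of the `Σ¹₁` formula `∃ X₁ ⋯ ∃ X_q φ`, with `p` free second-order
variables interpreted by `A` and `m` free first-order variables interpreted by `v`. -/
def SatSigma {lam : Ordinal.{u}} {p q m : ℕ}
    (φ : (setLang.sum (varLang (Fin p ⊕ Fin q))).Formula (Fin m))
    (A : Fin p → Set (VSet lam)) (v : Fin m → VSet lam) : Prop :=
  ∃ X : Fin q → Set (VSet lam), Sat φ (Sum.elim A X) v

/-- `f : V_λ → V_λ` preserves all `Σ¹₁` formulas, in both directions, with parameters that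
are elements `x` of `V_λ` (sent to `f x`) or subsets `A` of `V_λ` (sent to `f · A`). -/
def IsSigmaOneOne {lam : Ordinal.{u}} (f : VSet lam → VSet lam) : Prop :=
  ∀ (p q m : ℕ) (φ : (setLang.sum (varLang (Fin p ⊕ Fin q))).Formula (Fin m))
    (A : Fin p → Set (VSet lam)) (v : Fin m → VSet lam),
    SatSigma φ A v ↔ SatSigma φ (fun i => extend f (A i)) (fun i => f (v i))

/-! ### Definability -/

/-- `Def^{V_λ}(A)`: the elements of `V_λ` definable in `(V_λ, ∈)` by a first-order formula
with parameters from `A`. -/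
def defClosure {lam : Ordinal.{u}} (A : Set (VSet lam)) : Set (VSet lam) :=
  {b | A.Definable₁ setLang {b}}

/-- The interval `[α, β)` of ordinals, as a subset of `V_λ`. -/
def ordInterval (lam α β : Ordinal.{u}) : Set (VSet lam) :=
  {x | ∃ γ, α ≤ γ ∧ γ < β ∧ x.1 = γ.toZFSet}

/-- `V_α`, as a subset of `V_λ`. -/
def levelSet (lam α : Ordinal.{u}) : Set (VSet lam) := {x | x.1 ∈ V_ α}

end RankToRank

end

/-! Only first-order statements about classes are transferred along `j`. That the class `g` is a
function preserving a given formula, and that the extension of `g` sends the class `A` to `B`, are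
such statements, so the right powers `j^(n)` are elementary and satisfy
`j^(i) ∘ j^(m) = j^(m+1) ∘ j^(i)` for `i ≤ m`. Moreover `j^(n)` is the identity below `κₙ`, which it
sends to `κₙ₊₁`.

By Kunen's argument the `κₙ` are cofinal in `λ`. Otherwise `j` fixes their supremum `η` and hence
`V_η`. A well-ordering of the subsets of `V_η` yields a function `g` that maps the range of every
injection from these subsets, of the form `A ↦ f · A` with `f ⊆ V_η`, onto all of them; so does
`j g`. As `A ↦ j A` is of this form, `κ₀` is some `(j g) (j A) = j (g A)`, but `κ₀` is not a value
of `j`.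

So every point is fixed by almost all `j^(n)`, and `k` is pointwise a finite composition. Write
`j^(n,r)` for `j^(n) ∘ ⋯ ∘ j^(n+r-1)` and let `m = n + n`. Moving `j^(0,n)` across the remaining
factors one by one gives `k a = j^(0,n) (j^(n,r) a) = j^(m,r) (j^(0,n) a)` for large `r`. Hence each
element of `rng k ∪ V_{κₘ}`, and therefore each element definable from finitely many of them, is in
the range of the elementary embedding `j^(m,r)` for large `r`. This range misses `[κₘ, κₘ₊₁)`,
because `j^(m,r)` has critical point `κₘ` and sends it to `κₘ₊₁`. -/

namespace RankToRank

variable {lam : Ordinal.{u}}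

/-! ### Expressible relations -/

section Expressible

variable {Γ : Type*} {ι α β : Type}

/-- The relation `R`, between a parameter `γ` and a tuple `v` of elements of `V_λ`, is defined over
`(V_λ, ∈)` by one formula without second-order quantifiers whose second-order variables are
interpreted by the classes `S γ i`. Closure properties of this predicate take the place of writing
out formulas. -/
def Expressible (S : Γ → ι → Set (VSet lam)) (R : Γ → (α → VSet lam) → Prop) : Prop :=
  ∃ φ : (setLang.sum (varLang ι)).Formula α, ∀ γ v, Sat φ (S γ) v ↔ R γ v

namespace Expressible

open FirstOrder Language

variable {S : Γ → ι → Set (VSet lam)} {R R' : Γ → (α → VSet lam) → Prop}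

theorem congr (hR : ∀ γ v, R γ v ↔ R' γ v) (h : Expressible S R') : Expressible S R :=
  let ⟨φ, hφ⟩ := h
  ⟨φ, fun γ v => (hφ γ v).trans (hR γ v).symm⟩

theorem eq (a b : α) : Expressible S fun _ v => v a = v b :=
  ⟨(Term.var a).equal (Term.var b), fun _ _ => Iff.rfl⟩

theorem mem (a b : α) : Expressible S fun _ v => (v a).1 ∈ (v b).1 :=
  ⟨Relations.formula₂ (L := setLang.sum (varLang ι)) (Sum.inl SetRel.mem) (.var a) (.var b),
    fun _ _ => Iff.rfl⟩

theorem mem_class (i : ι) (a : α) : Expressible S fun γ v => v a ∈ S γ i :=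
  ⟨Relations.formula₁ (L := setLang.sum (varLang ι)) (Sum.inr (VarRel.var i)) (.var a),
    fun _ _ => Iff.rfl⟩

theorem not (h : Expressible S R) : Expressible S fun γ v => ¬ R γ v :=
  let ⟨φ, hφ⟩ := h
  ⟨φ.not, fun γ v => not_congr (hφ γ v)⟩

theorem imp (h : Expressible S R) (h' : Expressible S R') :
    Expressible S fun γ v => R γ v → R' γ v :=
  let ⟨φ, hφ⟩ := h
  let ⟨ψ, hψ⟩ := h'
  ⟨φ.imp ψ, fun γ v => imp_congr (hφ γ v) (hψ γ v)⟩

theorem and (h : Expressible S R) (h' : Expressible S R') :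
    Expressible S fun γ v => R γ v ∧ R' γ v :=
  .congr (fun _ _ => by tauto) (h.imp h'.not).not

theorem or (h : Expressible S R) (h' : Expressible S R') :
    Expressible S fun γ v => R γ v ∨ R' γ v :=
  .congr (fun _ _ => or_iff_not_imp_left) (h.not.imp h')

theorem iff (h : Expressible S R) (h' : Expressible S R') :
    Expressible S fun γ v => R γ v ↔ R' γ v :=
  .congr (fun _ _ => iff_iff_implies_and_implies) ((h.imp h').and (h'.imp h))

theorem exists_pi [Finite β] {R : Γ → (α → VSet lam) → (β → VSet lam) → Prop}
    (h : Expressible S fun γ (w : α ⊕ β → VSet lam) => R γ (w ∘ Sum.inl) (w ∘ Sum.inr)) :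
    Expressible S fun γ v => ∃ x, R γ v x := by
  obtain ⟨φ, hφ⟩ := h
  refine ⟨φ.iExs β, fun γ v => ?_⟩
  let _ := varStructure (S γ)
  exact Formula.realize_iExs.trans (exists_congr fun x => hφ γ (Sum.elim v x))

theorem forall_pi [Finite β] {R : Γ → (α → VSet lam) → (β → VSet lam) → Prop}
    (h : Expressible S fun γ (w : α ⊕ β → VSet lam) => R γ (w ∘ Sum.inl) (w ∘ Sum.inr)) :
    Expressible S fun γ v => ∀ x, R γ v x :=
  .congr (fun _ _ => not_exists_not.symm) (exists_pi h.not).not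

theorem ex {R : Γ → (α → VSet lam) → VSet lam → Prop}
    (h : Expressible S fun γ (w : α ⊕ Unit → VSet lam) => R γ (fun a => w (.inl a)) (w (.inr ()))) :
    Expressible S fun γ v => ∃ x, R γ v x :=
  .congr (fun _ _ => ⟨fun ⟨x, hx⟩ => ⟨fun _ => x, hx⟩, fun ⟨x, hx⟩ => ⟨x (), hx⟩⟩)
    (exists_pi (R := fun γ v (x : Unit → VSet lam) => R γ v (x ())) h)

theorem all {R : Γ → (α → VSet lam) → VSet lam → Prop}
    (h : Expressible S fun γ (w : α ⊕ Unit → VSet lam) => R γ (fun a => w (.inl a)) (w (.inr ()))) :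
    Expressible S fun γ v => ∀ x, R γ v x :=
  .congr (fun _ _ => not_exists_not.symm) (ex h.not).not

theorem forall_index [Finite β] {R : β → Γ → (α → VSet lam) → Prop}
    (h : ∀ b, Expressible S (R b)) : Expressible S fun γ v => ∀ b, R b γ v := by
  choose φ hφ using h
  refine ⟨Formula.iInf φ, fun γ v => ?_⟩
  let _ := varStructure (S γ)
  exact Formula.realize_iInf.trans (forall_congr' fun b => hφ b γ v)

theorem realize (φ : setLang.Formula β) (e : β → α) :
    Expressible S fun _ v => φ.Realize fun b => v (e b) := by
  refine ⟨(LHom.sumInl.onFormula φ).relabel e, fun γ v => ?_⟩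
  let _ := varStructure (S γ)
  exact Formula.realize_relabel.trans (LHom.realize_onFormula _ φ)

theorem map_iff {R : (α → VSet lam) → Prop}
    (h : Expressible (fun (_ : Unit) (i : Empty) => i.elim) fun _ => R)
    (e : VSet lam ↪ₑ[setLang] VSet lam) (v : α → VSet lam) : R v ↔ R fun a => e (v a) := by
  obtain ⟨φ, hφ⟩ := h
  let forget : setLang.sum (varLang Empty) →ᴸ setLang :=
    (LHom.id setLang).sumElim ⟨fun _ f => (nomatch f), fun _ r => (nomatch r)⟩
  let _ := varStructure (M := VSet lam) (Empty.elim : Empty → Set (VSet lam))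
  have : forget.IsExpansionOn (VSet lam) := by
    refine ⟨fun f => ?_, fun r => ?_⟩
    · rcases f with f | f <;> exact nomatch f
    · rcases r with r | ⟨⟨i⟩⟩
      exacts [fun _ => rfl, i.elim]
  have key (w : α → VSet lam) : (forget.onFormula φ).Realize w ↔ R w :=
    (LHom.realize_onFormula forget φ).trans (hφ () w)
  rw [← key, ← key, ← e.map_formula]
  rfl

end Expressible

end Expressible

/-! ### Pairs and graphs -/

/-- An element of an element of `V_λ`, as an element of `V_λ`. -/
def ofMem {y : ZFSet.{u}} (x : VSet lam) (h : y ∈ x.1) : VSet lam :=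
  ⟨y, (ZFSet.isTransitive_vonNeumann lam).subset_of_mem x.2 h⟩

theorem VSet.ext_mem {x y : VSet lam} (h : ∀ z : VSet lam, z.1 ∈ x.1 ↔ z.1 ∈ y.1) : x = y :=
  Subtype.ext <| ZFSet.ext fun _ =>
    ⟨fun hz => (h (ofMem x hz)).1 hz, fun hz => (h (ofMem y hz)).2 hz⟩

theorem subset_iff_forall {x y : VSet lam} :
    x.1 ⊆ y.1 ↔ ∀ z : VSet lam, z.1 ∈ x.1 → z.1 ∈ y.1 :=
  ⟨fun h _ hz => h hz, fun h _ hz => h (ofMem x hz) hz⟩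

theorem eq_unorderedPair_iff {x y q : VSet lam} :
    q.1 = {x.1, y.1} ↔ ∀ z : VSet lam, z.1 ∈ q.1 ↔ z = x ∨ z = y := by
  constructor
  · intro h z
    simp only [h, ZFSet.mem_pair, Subtype.ext_iff]
  · intro h
    refine ZFSet.ext fun z => ⟨fun hz => ?_, fun hz => ?_⟩
    · simpa only [ZFSet.mem_pair, Subtype.ext_iff, ofMem] using (h (ofMem q hz)).1 hz
    · rcases ZFSet.mem_pair.1 hz with rfl | rfl
      exacts [(h x).2 (.inl rfl), (h y).2 (.inr rfl)]

theorem eq_pair_iff {x y q : VSet lam} : q.1 = ZFSet.pair x.1 y.1 ↔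
    ∃ s t : VSet lam, s.1 = {x.1, x.1} ∧ t.1 = {x.1, y.1} ∧ q.1 = {s.1, t.1} := by
  constructor
  · intro h
    have hs : {x.1} ∈ q.1 := by rw [h]; exact ZFSet.mem_pair.2 (.inl rfl)
    have ht : {x.1, y.1} ∈ q.1 := by rw [h]; exact ZFSet.mem_pair.2 (.inr rfl)
    exact ⟨ofMem q hs, ofMem q ht, (ZFSet.pair_eq_singleton _).symm, rfl, h⟩
  · rintro ⟨s, t, hs, ht, hq⟩
    rw [hq, hs, ht, ZFSet.pair_eq_singleton, ZFSet.pair]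

theorem pair_mem_iff {x y s : VSet lam} :
    ZFSet.pair x.1 y.1 ∈ s.1 ↔ ∃ q : VSet lam, q.1 = ZFSet.pair x.1 y.1 ∧ q.1 ∈ s.1 :=
  ⟨fun h => ⟨ofMem s h, rfl, h⟩, fun ⟨_, hq, hs⟩ => hq ▸ hs⟩

namespace Expressible

variable {Γ : Type*} {ι α : Type} {S : Γ → ι → Set (VSet lam)}

theorem subset (a b : α) : Expressible S fun _ v => (v a).1 ⊆ (v b).1 :=
  .congr (fun _ _ => subset_iff_forall) (.all (.imp (.mem _ _) (.mem _ _)))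

theorem eq_unorderedPair (a b q : α) : Expressible S fun _ v => (v q).1 = {(v a).1, (v b).1} :=
  .congr (fun _ _ => eq_unorderedPair_iff) (.all (.iff (.mem _ _) (.or (.eq _ _) (.eq _ _))))

theorem eq_pair (a b q : α) : Expressible S fun _ v => (v q).1 = ZFSet.pair (v a).1 (v b).1 :=
  .congr (fun _ _ => eq_pair_iff) (.ex (.ex (.and (.eq_unorderedPair _ _ _)
    (.and (.eq_unorderedPair _ _ _) (.eq_unorderedPair _ _ _)))))

theorem pair_mem (a b s : α) : Expressible S fun _ v => ZFSet.pair (v a).1 (v b).1 ∈ (v s).1 :=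
  .congr (fun _ _ => pair_mem_iff) (.ex (.and (.eq_pair _ _ _) (.mem _ _)))

end Expressible

section Graph

theorem vonNeumann_insert_mem (hlam : Order.IsSuccLimit lam) {x y : ZFSet.{u}} (hx : x ∈ V_ lam)
    (hy : y ∈ V_ lam) : insert x y ∈ V_ lam := by
  rw [ZFSet.mem_vonNeumann] at *
  rw [ZFSet.rank_insert]
  exact max_lt (hlam.succ_lt hx) hy

theorem singleton_mem_vonNeumann (hlam : Order.IsSuccLimit lam) {x : ZFSet.{u}}
    (hx : x ∈ V_ lam) : {x} ∈ V_ lam := by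
  rw [ZFSet.mem_vonNeumann] at *
  rw [ZFSet.rank_singleton]
  exact hlam.succ_lt hx

theorem pair_mem_vonNeumann (hlam : Order.IsSuccLimit lam) {x y : ZFSet.{u}} (hx : x ∈ V_ lam)
    (hy : y ∈ V_ lam) : ZFSet.pair x y ∈ V_ lam :=
  vonNeumann_insert_mem hlam (singleton_mem_vonNeumann hlam hx)
    (singleton_mem_vonNeumann hlam
      (vonNeumann_insert_mem hlam hx (singleton_mem_vonNeumann hlam hy)))

variable {g h : VSet lam → VSet lam}

theorem mem_graphOf_iff {q x y : VSet lam} (hq : q.1 = ZFSet.pair x.1 y.1) :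
    q ∈ graphOf g ↔ g x = y := by
  constructor
  · rintro ⟨z, hz⟩
    rw [hq, ZFSet.pair_inj] at hz
    rw [Subtype.ext hz.1, Subtype.ext hz.2]
  · rintro rfl
    exact ⟨x, hq⟩

theorem exists_pair_mem_graphOf_iff (hlam : Order.IsSuccLimit lam) {x y : VSet lam} :
    (∃ q ∈ graphOf g, q.1 = ZFSet.pair x.1 y.1) ↔ g x = y :=
  ⟨fun ⟨_, hq, h⟩ => (mem_graphOf_iff h).1 hq,
    fun h => ⟨⟨_, pair_mem_vonNeumann hlam x.2 y.2⟩, (mem_graphOf_iff rfl).2 h, rfl⟩⟩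

theorem exists_eq_graphOf_iff (hlam : Order.IsSuccLimit lam) {A : Set (VSet lam)} :
    (∃ g, A = graphOf g) ↔ (∀ q ∈ A, ∃ x y : VSet lam, q.1 = ZFSet.pair x.1 y.1) ∧
      ∀ x : VSet lam, ∃ y, ∀ z : VSet lam, (∃ q ∈ A, q.1 = ZFSet.pair x.1 z.1) ↔ y = z := by
  constructor
  · rintro ⟨g, rfl⟩
    exact ⟨fun q ⟨x, hx⟩ => ⟨x, g x, hx⟩, fun x => ⟨g x, fun z => exists_pair_mem_graphOf_iff hlam⟩⟩
  · rintro ⟨hpair, hfun⟩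
    choose g hg using hfun
    refine ⟨g, Set.ext fun q => ⟨fun hq => ?_, ?_⟩⟩
    · obtain ⟨x, y, hxy⟩ := hpair q hq
      exact (mem_graphOf_iff hxy).2 ((hg x y).1 ⟨q, hq, hxy⟩)
    · rintro ⟨x, hx⟩
      obtain ⟨q', hq', h⟩ := (hg x _).2 rfl
      rwa [Subtype.ext (hx.trans h.symm)]

theorem app_eq (hlam : Order.IsSuccLimit lam) {f : VSet lam → VSet lam}
    (H : extend f (graphOf g) = graphOf h) : app f g = h := by
  ext1 x
  rw [app, H]
  exact ((exists_pair_mem_graphOf_iff hlam).1 (Classical.epsilon_spec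
    (p := fun y => ∃ p ∈ graphOf h, p.1 = ZFSet.pair x.1 y.1)
    ⟨h x, (exists_pair_mem_graphOf_iff hlam).2 rfl⟩)).symm

/-- The graphs of a tuple of functions, as an interpretation of second-order variables. -/
def graphs {ι : Type} (g : ι → VSet lam → VSet lam) (i : ι) : Set (VSet lam) := graphOf (g i)

end Graph

namespace Expressible

variable {Γ : Type*} {ι α β : Type}

theorem exists_pair_mem_class {S : Γ → ι → Set (VSet lam)} (i : ι) (a b : α) :
    Expressible S fun γ v => ∃ q ∈ S γ i, q.1 = ZFSet.pair (v a).1 (v b).1 :=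
  .ex (.and (.mem_class i _) (.eq_pair _ _ _))

theorem exists_eq_graphOf (hlam : Order.IsSuccLimit lam) (i : ι) :
    Expressible (α := α) id fun (A : ι → Set (VSet lam)) _ => ∃ g, A i = graphOf g :=
  .congr (fun _ _ => exists_eq_graphOf_iff hlam)
    (.and (.all (.imp (.mem_class i _) (.ex (.ex (.eq_pair _ _ _)))))
      (.all (.ex (.all (.iff (.exists_pair_mem_class i _ _) (.eq _ _))))))

variable (hlam : Order.IsSuccLimit lam)
include hlam

theorem apply_eq (i : ι) (a b : α) :
    Expressible (graphs (lam := lam)) fun g v => g i (v a) = v b :=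
  .congr (fun _ _ => (exists_pair_mem_graphOf_iff hlam).symm) (.exists_pair_mem_class i _ _)

theorem apply_mem (i : ι) (a b : α) :
    Expressible (graphs (lam := lam)) fun g v => (g i (v a)).1 ∈ (v b).1 :=
  .congr (R' := fun g v => ∃ y, g i (v a) = y ∧ y.1 ∈ (v b).1)
    (by simp only [exists_eq_left', implies_true]) (.ex (.and (.apply_eq hlam i _ _) (.mem _ _)))

theorem mem_apply (i : ι) (a b : α) :
    Expressible (graphs (lam := lam)) fun g v => (v a).1 ∈ (g i (v b)).1 :=
  .congr (R' := fun g v => ∃ y, g i (v b) = y ∧ (v a).1 ∈ y.1)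
    (by simp only [exists_eq_left', implies_true]) (.ex (.and (.apply_eq hlam i _ _) (.mem _ _)))

theorem realize_apply [Finite β] (φ : setLang.Formula β) (i : ι) (e : β → α) :
    Expressible (graphs (lam := lam)) fun g v => φ.Realize fun b => g i (v (e b)) :=
  .congr (R' := fun g v => ∃ u : β → VSet lam, (∀ b, g i (v (e b)) = u b) ∧ φ.Realize u)
    (fun _ _ => ⟨fun h => ⟨_, fun _ => rfl, h⟩, fun ⟨_, hu, h⟩ => funext hu ▸ h⟩)
    (.exists_pi (.and (.forall_index fun b => .apply_eq hlam i (Sum.inl (e b)) (Sum.inr b))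
      (.realize φ Sum.inr)))

end Expressible

/-! ### Elementary embeddings and their action on classes -/

section Elementary

theorem mem_cut_iff {A : Set (VSet lam)} {α : Set.Iio lam} {x : VSet lam} :
    x.1 ∈ (cut A α).1 ↔ x.1.rank < α ∧ x ∈ A := by
  rw [cut, ZFSet.mem_sep, ZFSet.mem_vonNeumann, exists_prop_of_true x.2]

theorem rank_cut_le (A : Set (VSet lam)) (α : Set.Iio lam) : (cut A α).1.rank ≤ α :=
  ZFSet.rank_le_iff.2 fun _ hz => (mem_cut_iff (x := ofMem _ hz).1 hz).1

variable (e : VSet lam ↪ₑ[setLang] VSet lam)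

theorem map_mem_map_iff {x y : VSet lam} : (e x).1 ∈ (e y).1 ↔ x.1 ∈ y.1 :=
  e.map_rel SetRel.mem ![x, y]

theorem map_subset_map_iff {x y : VSet lam} : (e x).1 ⊆ (e y).1 ↔ x.1 ⊆ y.1 :=
  ((Expressible.subset (0 : Fin 2) 1).map_iff e ![x, y]).symm

theorem map_eq_pair_iff {x y q : VSet lam} :
    (e q).1 = ZFSet.pair (e x).1 (e y).1 ↔ q.1 = ZFSet.pair x.1 y.1 :=
  ((Expressible.eq_pair (0 : Fin 3) 1 2).map_iff e ![x, y, q]).symm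

theorem mem_extend_iff {A : Set (VSet lam)} {y : VSet lam} :
    y ∈ extend e A ↔ ∃ c : VSet lam, (∀ z : VSet lam, z.1 ∈ c.1 → z ∈ A) ∧ y.1 ∈ (e c).1 := by
  simp only [extend, Set.mem_iUnion]
  constructor
  · rintro ⟨α, hα⟩
    exact ⟨cut A α, fun z hz => (mem_cut_iff.1 hz).2, hα⟩
  · rintro ⟨c, hcA, hy⟩
    refine ⟨⟨c.1.rank, ZFSet.mem_vonNeumann.1 c.2⟩, (map_subset_map_iff e).2 ?_ hy⟩
    exact subset_iff_forall.2 fun z hz => mem_cut_iff.2 ⟨ZFSet.rank_lt_of_mem hz, hcA z hz⟩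

theorem map_mem_extend (hlam : Order.IsSuccLimit lam) {A : Set (VSet lam)} {x : VSet lam}
    (hx : x ∈ A) : e x ∈ extend e A :=
  (mem_extend_iff e).2 ⟨⟨{x.1}, singleton_mem_vonNeumann hlam x.2⟩,
    fun _ hz => Subtype.ext (ZFSet.mem_singleton.1 hz) ▸ hx,
    (map_mem_map_iff e).2 (ZFSet.mem_singleton.2 rfl)⟩

theorem map_apply_of_extend_graphOf (hlam : Order.IsSuccLimit lam) {g h : VSet lam → VSet lam}
    (H : extend e (graphOf g) = graphOf h) (x : VSet lam) : e (g x) = h (e x) := by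
  have hq := map_mem_extend e hlam (x := ⟨_, pair_mem_vonNeumann hlam x.2 (g x).2⟩)
    ((mem_graphOf_iff rfl).2 rfl : _ ∈ graphOf g)
  rw [H, mem_graphOf_iff ((map_eq_pair_iff e).2 rfl)] at hq
  exact hq.symm

theorem extend_graphOf_eq_iff {g h : VSet lam → VSet lam} :
    extend e (graphOf g) = graphOf h ↔ ∀ q, q ∈ graphOf h ↔
      ∃ c, (∀ z : VSet lam, z.1 ∈ c.1 → z ∈ graphOf g) ∧ q.1 ∈ (e c).1 := by
  simp only [Set.ext_iff, mem_extend_iff, iff_comm (a := _ ∈ graphOf h)]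

end Elementary

/-! ### Transfer along a `Σ¹₀`-elementary map -/

/-- `f` preserves the formulas without second-order quantifiers, with elements and subsets of `V_λ`
as parameters: the case `q = 0` of `IsSigmaOneOne`. -/
def IsSigmaOneZero (f : VSet lam → VSet lam) : Prop :=
  ∀ (p m : ℕ) (φ : (setLang.sum (varLang (Fin p))).Formula (Fin m))
    (A : Fin p → Set (VSet lam)) (v : Fin m → VSet lam),
    Sat φ A v ↔ Sat φ (fun i => extend f (A i)) (fun i => f (v i))

open FirstOrder Language in
theorem IsSigmaOneOne.isSigmaOneZero {f : VSet lam → VSet lam} (hf : IsSigmaOneOne f) :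
    IsSigmaOneZero f := by
  intro p m φ A v
  let addVars : varLang (Fin p) →ᴸ varLang (Fin p ⊕ Fin 0) :=
    ⟨fun _ f => (nomatch f), fun _ r => match r with | .var i => .var (.inl i)⟩
  let ψ := ((LHom.id setLang).sumMap addVars).onFormula φ
  have key (B : Fin p → Set (VSet lam)) (w : Fin m → VSet lam) : SatSigma ψ B w ↔ Sat φ B w := by
    suffices h : ∀ X, Sat ψ (Sum.elim B X) w ↔ Sat φ B w from
      ⟨fun ⟨X, hX⟩ => (h X).1 hX, fun hφ => ⟨Fin.elim0, (h _).2 hφ⟩⟩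
    intro X
    let _ := varStructure B
    let _ := varStructure (Sum.elim B X)
    have : addVars.IsExpansionOn (VSet lam) :=
      ⟨fun f => (nomatch f), by rintro _ ⟨_⟩ _; rfl⟩
    exact LHom.realize_onFormula _ φ
  rw [← key, ← key, hf p 0 m ψ]

namespace IsSigmaOneZero

variable {p m : ℕ} {j : VSet lam → VSet lam} (hj : IsSigmaOneZero j)
include hj

theorem transfer_class {R : (Fin p → Set (VSet lam)) → (Fin m → VSet lam) → Prop}
    (hR : Expressible id R) (A : Fin p → Set (VSet lam)) (v : Fin m → VSet lam) :
    R A v ↔ R (fun i => extend j (A i)) (fun i => j (v i)) :=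
  let ⟨φ, hφ⟩ := hR
  (hφ _ _).symm.trans ((hj p m φ A v).trans (hφ _ _))

variable (hlam : Order.IsSuccLimit lam)
include hlam

theorem extend_graphOf (g : VSet lam → VSet lam) : extend j (graphOf g) = graphOf (app j g) := by
  obtain ⟨h, hh⟩ := (hj.transfer_class (Expressible.exists_eq_graphOf hlam (0 : Fin 1))
    (fun _ => graphOf g) (Fin.elim0 : Fin 0 → VSet lam)).1 ⟨g, rfl⟩
  rw [app_eq hlam hh]
  exact hh

theorem transfer {R : (Fin p → VSet lam → VSet lam) → (Fin m → VSet lam) → Prop}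
    (hR : Expressible graphs R) (g : Fin p → VSet lam → VSet lam) (v : Fin m → VSet lam) :
    R g v ↔ R (fun i => app j (g i)) (fun i => j (v i)) := by
  obtain ⟨φ, hφ⟩ := hR
  have hS : (fun i => extend j (graphs g i)) = graphs fun i => app j (g i) :=
    funext fun i => hj.extend_graphOf hlam (g i)
  rw [← hφ, hj p m φ, hS, hφ]

theorem map_apply (g : VSet lam → VSet lam) (x : VSet lam) : j (g x) = app j g (j x) :=
  ((hj.transfer hlam (.apply_eq hlam (0 : Fin 1) (0 : Fin 2) 1) (fun _ => g) ![x, g x]).1 rfl).symm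

end IsSigmaOneZero

/-! ### Iterated application -/

section Iterates

variable (hlam : Order.IsSuccLimit lam)

/-- The application `f e` of a `Σ¹₀`-elementary map `f` to an elementary embedding `e`, as an
elementary embedding. -/
noncomputable def IsSigmaOneZero.appEmbedding {f : VSet lam → VSet lam} (hf : IsSigmaOneZero f)
    (e : VSet lam ↪ₑ[setLang] VSet lam) : VSet lam ↪ₑ[setLang] VSet lam where
  toFun := app f e
  map_formula' n φ w := by
    have hR : Expressible (graphs (ι := Fin 1)) fun g (_ : Fin 0 → VSet lam) =>
        ∀ w : Fin n → VSet lam, φ.Realize (fun i => g 0 (w i)) ↔ φ.Realize w :=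
      .forall_pi (.iff (.realize_apply hlam φ 0 Sum.inr) (.realize φ Sum.inr))
    exact (hf.transfer hlam hR (fun _ => e) Fin.elim0).1 (fun w => e.map_formula φ w) w

theorem IsSigmaOneZero.extend_appEmbedding {f : VSet lam → VSet lam} (hf : IsSigmaOneZero f)
    {e : VSet lam ↪ₑ[setLang] VSet lam} {g h : VSet lam → VSet lam}
    (H : extend e (graphOf g) = graphOf h) :
    extend (hf.appEmbedding hlam e) (graphOf (app f g)) = graphOf (app f h) := by
  have hR : Expressible (graphs (ι := Fin 3)) fun g (_ : Fin 0 → VSet lam) =>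
      ∀ q, q ∈ graphOf (g 2) ↔
        ∃ c, (∀ z : VSet lam, z.1 ∈ c.1 → z ∈ graphOf (g 1)) ∧ q.1 ∈ (g 0 c).1 :=
    .all (.iff (.mem_class _ _)
      (.ex (.and (.all (.imp (.mem _ _) (.mem_class _ _))) (.mem_apply hlam 0 _ _))))
  exact (extend_graphOf_eq_iff _).2 <|
    (hf.transfer hlam hR ![e, g, h] Fin.elim0).1 ((extend_graphOf_eq_iff e).1 H)

variable {j : VSet lam ↪ₑ[setLang] VSet lam} (hj : IsSigmaOneZero j)
include hlam hj

/-- The right powers of a `Σ¹₀`-elementary embedding, as elementary embeddings. They are generated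
by `j^(n+1) = j j^(n)`, which agrees with `rightPower` by `coe_rightPowerEmbedding`. -/
noncomputable def rightPowerEmbedding : ℕ → VSet lam ↪ₑ[setLang] VSet lam
  | 0 => j
  | n + 1 => hj.appEmbedding hlam (rightPowerEmbedding n)

theorem extend_rightPowerEmbedding {i m : ℕ} (him : i ≤ m) :
    extend (rightPowerEmbedding hlam hj i) (graphOf (rightPowerEmbedding hlam hj m)) =
      graphOf (rightPowerEmbedding hlam hj (m + 1)) := by
  induction i generalizing m with
  | zero => exact hj.extend_graphOf hlam _
  | succ i ih =>
    obtain ⟨m, rfl⟩ := Nat.exists_eq_succ_of_ne_zero (Nat.ne_zero_of_lt him)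
    exact hj.extend_appEmbedding hlam (ih (Nat.le_of_succ_le_succ him))

theorem coe_rightPowerEmbedding (n : ℕ) : ⇑(rightPowerEmbedding hlam hj n) = rightPower j n := by
  induction n with
  | zero => rfl
  | succ n ih =>
    rw [rightPower, ← ih, app_eq hlam (extend_rightPowerEmbedding hlam hj le_rfl)]

theorem graphOf_rightPower_succ (n : ℕ) : graphOf (rightPower j (n + 1)) =
    extend (rightPower j n) (graphOf (rightPower j n)) := by
  simp only [← coe_rightPowerEmbedding hlam hj, extend_rightPowerEmbedding hlam hj le_rfl]

theorem app_rightPower (n : ℕ) : app j (rightPower j n) = rightPower j (n + 1) := by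
  simp only [← coe_rightPowerEmbedding hlam hj]
  rfl

theorem rightPower_rightPower_apply {i m : ℕ} (him : i ≤ m) (x : VSet lam) :
    rightPower j i (rightPower j m x) = rightPower j (m + 1) (rightPower j i x) := by
  simp only [← coe_rightPowerEmbedding hlam hj]
  exact map_apply_of_extend_graphOf _ hlam (extend_rightPowerEmbedding hlam hj him) x

end Iterates

/-! ### Ranks and the critical sequence -/

theorem rank_lt (x : VSet lam) : x.1.rank < lam := ZFSet.mem_vonNeumann.1 x.2

/-- The rank of an element of `V_λ`, as an element of `V_λ`. -/
noncomputable def rankV (x : VSet lam) : VSet lam := ordV x.1.rank (rank_lt x)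

/-- `V_α`, as an element of `V_λ`. -/
noncomputable def levelV (α : Ordinal.{u}) (h : α < lam) : VSet lam :=
  ⟨V_ α, ZFSet.vonNeumann_mem_of_lt h⟩

theorem rank_ordV {α : Ordinal.{u}} (h : α < lam) : (ordV α h).1.rank = α :=
  Ordinal.rank_toZFSet α

theorem ordV_mem_ordV_iff {α β : Ordinal.{u}} {hα : α < lam} {hβ : β < lam} :
    (ordV α hα).1 ∈ (ordV β hβ).1 ↔ α < β :=
  Ordinal.toZFSet_mem_toZFSet_iff

theorem rankV_ordV {α : Ordinal.{u}} (h : α < lam) : rankV (ordV α h) = ordV α h := by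
  simp only [rankV, rank_ordV]

theorem mem_levelV_iff {α : Ordinal.{u}} (h : α < lam) {x : VSet lam} :
    x.1 ∈ (levelV α h).1 ↔ x.1.rank < α :=
  ZFSet.mem_vonNeumann

theorem rankV_mem_ordV_iff {α : Ordinal.{u}} (h : α < lam) {x : VSet lam} :
    (rankV x).1 ∈ (ordV α h).1 ↔ x.1.rank < α :=
  ordV_mem_ordV_iff

theorem mem_rankV_iff {x z : VSet lam} :
    z.1 ∈ (rankV x).1 ↔ ∃ w : VSet lam, w.1 ∈ x.1 ∧ (z.1 ∈ (rankV w).1 ∨ rankV w = z) := by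
  simp only [rankV, ordV, Ordinal.mem_toZFSet_iff, Subtype.ext_iff, ZFSet.lt_rank_iff]
  constructor
  · rintro ⟨a, ⟨w, hw, ha⟩, hz⟩
    obtain ha | ha := ha.lt_or_eq
    · exact ⟨ofMem x hw, hw, .inl ⟨a, ZFSet.lt_rank_iff.1 ha, hz⟩⟩
    · exact ⟨ofMem x hw, hw, .inr ((congrArg _ ha.symm).trans hz)⟩
  · rintro ⟨w, hw, ⟨a, ha, hz⟩ | hz⟩
    · exact ⟨a, ⟨w, hw, (ZFSet.lt_rank_iff.2 ha).le⟩, hz⟩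
    · exact ⟨_, ⟨w, hw, le_rfl⟩, hz⟩

theorem eq_rankV_iff {g : VSet lam → VSet lam} : g = rankV ↔
    ∀ x z : VSet lam, z.1 ∈ (g x).1 ↔ ∃ w : VSet lam, w.1 ∈ x.1 ∧ (z.1 ∈ (g w).1 ∨ g w = z) := by
  refine ⟨fun hg x z => hg ▸ mem_rankV_iff, fun hg => funext fun x => ?_⟩
  obtain ⟨x, hx⟩ := x
  induction x using ZFSet.inductionOn with
  | h x ih =>
    refine VSet.ext_mem fun z => ?_
    rw [hg, mem_rankV_iff]
    exact exists_congr fun w => and_congr_right fun hw => by rw [ih w.1 hw w.2]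

theorem onOrd_lt {f : VSet lam → VSet lam} {α : Ordinal.{u}} (h : α < lam) : onOrd f α < lam := by
  rw [onOrd, dif_pos h]
  exact rank_lt _

section CriticalSequence

variable {j : VSet lam ↪ₑ[setLang] VSet lam} (hlam : Order.IsSuccLimit lam) (hj : IsSigmaOneZero j)
include hlam hj

theorem app_rankV : app j rankV = rankV := by
  have hR : Expressible (graphs (ι := Fin 1)) fun g (_ : Fin 0 → VSet lam) =>
      ∀ x z, z.1 ∈ (g 0 x).1 ↔ ∃ w, w.1 ∈ x.1 ∧ (z.1 ∈ (g 0 w).1 ∨ g 0 w = z) :=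
    .all (.all (.iff (.mem_apply hlam 0 _ _)
      (.ex (.and (.mem _ _) (.or (.mem_apply hlam 0 _ _) (.apply_eq hlam 0 _ _))))))
  exact eq_rankV_iff.2 ((hj.transfer hlam hR (fun _ => rankV) Fin.elim0).1 (eq_rankV_iff.1 rfl))

theorem map_rankV (x : VSet lam) : j (rankV x) = rankV (j x) := by
  rw [hj.map_apply hlam, app_rankV hlam hj]

theorem map_ordV {α : Ordinal.{u}} (h : α < lam) :
    j (ordV α h) = ordV (onOrd j α) (onOrd_lt h) := by
  rw [← rankV_ordV, map_rankV hlam hj]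
  simp only [rankV, onOrd, dif_pos h]

theorem rank_map (x : VSet lam) : (j x).1.rank = onOrd j x.1.rank := by
  have h := map_rankV hlam hj x
  rw [rankV, map_ordV hlam hj] at h
  exact (Ordinal.toZFSet_injective (Subtype.ext_iff.1 h)).symm

theorem map_levelV {α : Ordinal.{u}} (h : α < lam) :
    j (levelV α h) = levelV (onOrd j α) (onOrd_lt h) := by
  have hR : Expressible (graphs (ι := Fin 1)) fun g (v : Fin 2 → VSet lam) =>
      ∀ x, x.1 ∈ (v 0).1 ↔ (g 0 x).1 ∈ (v 1).1 :=
    .all (.iff (.mem _ _) (.apply_mem hlam 0 _ _))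
  have hlevel := (hj.transfer hlam hR (fun _ => rankV) ![levelV α h, ordV α h]).1 fun x =>
    (mem_levelV_iff h).trans (rankV_mem_ordV_iff h).symm
  refine VSet.ext_mem fun x => (hlevel x).trans ?_
  simp only [app_rankV hlam hj, Matrix.cons_val, map_ordV hlam hj]
  exact (rankV_mem_ordV_iff _).trans (mem_levelV_iff _).symm

theorem onOrd_lt_onOrd {α β : Ordinal.{u}} (hαβ : α < β) (hβ : β < lam) :
    onOrd j α < onOrd j β := by
  have h := (map_mem_map_iff j).2
    (ordV_mem_ordV_iff (hα := hαβ.trans hβ) (hβ := hβ).2 hαβ)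
  rwa [map_ordV hlam hj, map_ordV hlam hj, ordV_mem_ordV_iff] at h

theorem le_onOrd {α : Ordinal.{u}} (hα : α < lam) : α ≤ onOrd j α := by
  induction α using WellFoundedLT.induction with
  | ind α ih =>
    by_contra! h
    exact (ih _ h (h.trans hα)).not_gt (onOrd_lt_onOrd hlam hj h hα)

theorem map_eq_self_of_forall_onOrd_le {x : VSet lam}
    (hx : ∀ α ≤ x.1.rank, onOrd j α ≤ α) : j x = x := by
  induction hr : x.1.rank using WellFoundedLT.induction generalizing x with
  | ind r ih =>
    subst hr
    have hfix {z : VSet lam} (hz : z.1.rank < x.1.rank) : j z = z :=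
      ih _ hz (fun α hα => hx α (hα.trans hz.le)) rfl
    have hrank : (j x).1.rank = x.1.rank :=
      (rank_map hlam hj x).trans (le_antisymm (hx _ le_rfl) (le_onOrd hlam hj (rank_lt x)))
    refine VSet.ext_mem fun z => ⟨fun hz => ?_, fun hz => ?_⟩
    · rwa [← map_mem_map_iff j, hfix ((ZFSet.rank_lt_of_mem hz).trans_eq hrank)]
    · rw [← hfix (ZFSet.rank_lt_of_mem hz)]
      exact (map_mem_map_iff j).2 hz

theorem map_eq_self_of_rank_lt_crit {x : VSet lam} (hx : x.1.rank < crit j) : j x = x :=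
  map_eq_self_of_forall_onOrd_le hlam hj fun _ hα => not_lt.1 fun h =>
    notMem_of_lt_csInf' (hα.trans_lt hx) ⟨hα.trans_lt (rank_lt x), h⟩

variable (hne : ∃ x, j x ≠ x)
include hne

theorem crit_mem : crit j < lam ∧ crit j < onOrd j (crit j) := by
  refine csInf_mem (s := {α | α < lam ∧ α < onOrd j α}) ?_
  by_contra hempty
  obtain ⟨x, hx⟩ := hne
  exact hx <| map_eq_self_of_forall_onOrd_le hlam hj fun α hα => not_lt.1 fun h =>
    hempty ⟨α, hα.trans_lt (rank_lt x), h⟩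

theorem critSeq_lt (n : ℕ) : critSeq j n < lam := by
  induction n with
  | zero => exact (crit_mem hlam hj hne).1
  | succ n ih => exact onOrd_lt ih

theorem critSeq_strictMono : StrictMono (critSeq j) := by
  refine strictMono_nat_of_lt_succ fun n => ?_
  induction n with
  | zero => exact (crit_mem hlam hj hne).2
  | succ n ih => exact onOrd_lt_onOrd hlam hj ih (critSeq_lt hlam hj hne _)

/-- The ordinal `κₙ` of the critical sequence, as an element of `V_λ`. -/
noncomputable def critV (n : ℕ) : VSet lam := ordV (critSeq j n) (critSeq_lt hlam hj hne n)

theorem critV_mem_critV_iff {m n : ℕ} :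
    (critV hlam hj hne m).1 ∈ (critV hlam hj hne n).1 ↔ m < n :=
  ordV_mem_ordV_iff.trans (critSeq_strictMono hlam hj hne).lt_iff_lt

theorem map_critV (n : ℕ) : j (critV hlam hj hne n) = critV hlam hj hne (n + 1) :=
  map_ordV hlam hj _

theorem map_ne_crit (x : VSet lam) : (j x).1 ≠ (crit j).toZFSet := by
  intro h
  obtain ⟨hlt, hmove⟩ := crit_mem hlam hj hne
  have hx : x.1 ∈ (ordV (crit j) hlt).1 := by
    rw [← map_mem_map_iff j, map_ordV hlam hj, h]
    exact Ordinal.toZFSet_mem_toZFSet_iff.2 hmove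
  have hrank := ZFSet.rank_lt_of_mem hx
  rw [rank_ordV] at hrank
  rw [map_eq_self_of_rank_lt_crit hlam hj hrank] at h
  rw [h, Ordinal.rank_toZFSet] at hrank
  exact hrank.false

theorem rightPower_critV (n : ℕ) :
    rightPower j n (critV hlam hj hne n) = critV hlam hj hne (n + 1) := by
  induction n with
  | zero => exact map_critV hlam hj hne 0
  | succ n ih =>
    have h : j (rightPower j n _) = rightPower j (n + 1) (j _) :=
      rightPower_rightPower_apply hlam hj n.zero_le (critV hlam hj hne n)
    rw [ih, map_critV, map_critV] at h
    exact h.symm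

theorem rightPower_eq_self {n : ℕ} {x : VSet lam} (hx : x.1.rank < critSeq j n) :
    rightPower j n x = x := by
  induction n generalizing x with
  | zero => exact map_eq_self_of_rank_lt_crit hlam hj hx
  | succ n ih =>
    have hR : Expressible (graphs (ι := Fin 1)) fun g (v : Fin 1 → VSet lam) =>
        ∀ x, x.1 ∈ (v 0).1 → g 0 x = x :=
      .all (.imp (.mem _ _) (.apply_eq hlam 0 _ _))
    have hfix := (hj.transfer hlam hR (fun _ => rightPower j n)
      fun _ => levelV (critSeq j n) (critSeq_lt hlam hj hne n)).1 fun x hx =>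
        ih ((mem_levelV_iff _).1 hx)
    rw [map_levelV hlam hj, app_rightPower hlam hj] at hfix
    exact hfix x ((mem_levelV_iff _).2 hx)

end CriticalSequence

/-! ### Kunen's theorem -/

/-- If `x ∈ K` has an element in `K`, then it has a largest such element. Every set of ordinals of
order type at most `ω` has this first-order property, and no member of a set with this property
contains an infinite increasing sequence from it. -/
def HasLargestPredecessors (K : VSet lam) : Prop :=
  ∀ x y : VSet lam, x.1 ∈ K.1 → y.1 ∈ K.1 → y.1 ∈ x.1 → ∃ m : VSet lam, m.1 ∈ K.1 ∧ m.1 ∈ x.1 ∧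
    ∀ z : VSet lam, z.1 ∈ K.1 → z.1 ∈ x.1 → z.1 ∈ m.1 ∨ z = m

theorem Expressible.hasLargestPredecessors {Γ : Type*} {ι α : Type} {S : Γ → ι → Set (VSet lam)}
    (a : α) : Expressible S fun _ v => HasLargestPredecessors (v a) :=
  .all (.all (.imp (.mem _ _) (.imp (.mem _ _) (.imp (.mem _ _) (.ex (.and (.mem _ _)
    (.and (.mem _ _) (.all (.imp (.mem _ _) (.imp (.mem _ _) (.or (.mem _ _) (.eq _ _))))))))))))

theorem HasLargestPredecessors.exists_notMem {K : VSet lam} (hK : HasLargestPredecessors K)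
    {s : ℕ → VSet lam} (hsK : ∀ n, (s n).1 ∈ K.1) (hs : ∀ n, (s n).1 ∈ (s (n + 1)).1)
    (x : VSet lam) (hx : x.1 ∈ K.1) : ∃ n, (s n).1 ∉ x.1 := by
  obtain ⟨x, hxV⟩ := x
  induction x using ZFSet.inductionOn with
  | h x ih =>
    by_contra! hsx
    obtain ⟨m, hmK, hmx, hm⟩ := hK ⟨x, hxV⟩ (s 0) hx (hsK 0) (hsx 0)
    obtain ⟨n, hn⟩ := ih m.1 hmx m.2 hmK
    have hnm : s n = m := (hm _ (hsK n) (hsx n)).resolve_left hn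
    rcases hm _ (hsK (n + 1)) (hsx (n + 1)) with h | h
    · exact ZFSet.mem_asymm (hs n) (hnm ▸ h)
    · exact ZFSet.mem_irrefl _ (h.trans hnm.symm ▸ hs n)

section Jonsson

universe v

open Cardinal

theorem exists_injective_choice {I X : Type v} {S : I → Set X} (hS : ∀ i, #I ≤ #(S i)) :
    ∃ s : I → X, Function.Injective s ∧ ∀ i, s i ∈ S i := by
  obtain ⟨_, _, hI⟩ := exists_ord_eq_type_lt I
  have key (i : I) (g : ∀ i', i' < i → X) : ∃ x ∈ S i, ∀ i' hi', g i' hi' ≠ x := by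
    by_contra! h
    choose f hf hgf using h
    have hinj : Function.Injective fun x : S i => (⟨f x x.2, hf x x.2⟩ : Set.Iio i) := by
      intro x y hxy
      have hfxy : f x x.2 = f y y.2 := congrArg Subtype.val hxy
      refine Subtype.ext ?_
      rw [← hgf x x.2, ← hgf y y.2]
      congr 1
    exact ((mk_Iio_lt i hI).trans_le (hS i)).not_ge (mk_le_of_injective hinj)
  choose next hnext hne using key
  let s : I → X := wellFounded_lt.fix next
  have hs (i : I) : s i = next i fun i' _ => s i' := wellFounded_lt.fix_eq next i
  have hslt {i i' : I} (h : i' < i) : s i' ≠ s i :=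
    hs i ▸ hne i (fun i' _ => s i') i' h
  refine ⟨s, fun i i' h => ?_, fun i => hs i ▸ hnext _ _⟩
  by_contra hii'
  exact (lt_or_gt_of_ne hii').elim (fun hlt => hslt hlt h) fun hlt => hslt hlt h.symm

theorem exists_forall_surjective_comp {Y Z : Type v} [Infinite Y] (Φ : Y → Y → Z) :
    ∃ F : Z → Y, ∀ i, Function.Injective (Φ i) → Function.Surjective (F ∘ Φ i) := by
  let I := {i // Function.Injective (Φ i)} × Y
  have hI : #I ≤ #Y := by
    rw [mk_prod, lift_id, lift_id]
    exact (mul_le_mul_left (mk_subtype_le _) _).trans (mul_eq_self (aleph0_le_mk Y)).le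
  obtain ⟨s, hs, hsS⟩ := exists_injective_choice (S := fun x : I => Set.range (Φ x.1))
    fun x => hI.trans (mk_range_eq _ x.1.2).ge
  refine ⟨Function.extend s Prod.snd fun _ => Classical.arbitrary Y, fun i hi b => ?_⟩
  obtain ⟨y, hy⟩ := hsS (⟨i, hi⟩, b)
  exact ⟨y, (congrArg _ hy).trans (hs.extend_apply _ _ _)⟩

end Jonsson

/-- The union of the values at subsets of `A` of the function with graph `i`, as an element of
`V_λ`: for `i` in the role of `f`, the analogue of `f · A`. -/
noncomputable def unionImage (i A : VSet lam) : VSet lam :=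
  cut {y | ∃ c d : VSet lam, c.1 ⊆ A.1 ∧ ZFSet.pair c.1 d.1 ∈ i.1 ∧ y.1 ∈ d.1}
    ⟨i.1.rank, rank_lt i⟩

theorem mem_unionImage_iff {i A y : VSet lam} : y.1 ∈ (unionImage i A).1 ↔
    ∃ c d : VSet lam, c.1 ⊆ A.1 ∧ ZFSet.pair c.1 d.1 ∈ i.1 ∧ y.1 ∈ d.1 := by
  refine mem_cut_iff.trans ⟨And.right, fun h => ⟨?_, h⟩⟩
  obtain ⟨c, d, -, hcd, hy⟩ := h
  calc y.1.rank < d.1.rank := ZFSet.rank_lt_of_mem hy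
    _ < ({c.1, d.1} : ZFSet).rank := ZFSet.rank_lt_of_mem (ZFSet.mem_pair.2 (.inr rfl))
    _ < (ZFSet.pair c.1 d.1).rank := ZFSet.rank_lt_of_mem (ZFSet.mem_pair.2 (.inr rfl))
    _ < i.1.rank := ZFSet.rank_lt_of_mem hcd

theorem Expressible.unionImage_eq {Γ : Type*} {ι α : Type} {S : Γ → ι → Set (VSet lam)}
    (i a u : α) : Expressible S fun _ v => unionImage (v i) (v a) = v u :=
  .congr (R' := fun _ v => ∀ y : VSet lam,
      (∃ c d : VSet lam, c.1 ⊆ (v a).1 ∧ ZFSet.pair c.1 d.1 ∈ (v i).1 ∧ y.1 ∈ d.1) ↔ y.1 ∈ (v u).1)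
    (fun _ _ => ⟨fun h _ => h ▸ mem_unionImage_iff.symm,
      fun h => VSet.ext_mem fun y => mem_unionImage_iff.trans (h y)⟩)
    (.all (.iff (.ex (.ex (.and (.subset _ _) (.and (.pair_mem _ _ _) (.mem _ _))))) (.mem _ _)))

/-- `g` is a Jónsson function for `w`: for every `i` such that `A ↦ unionImage i A` is injective on
the subsets of `w`, it maps the values of `unionImage i` at these onto all subsets of `w`. -/
def IsJonsson (g : VSet lam → VSet lam) (w : VSet lam) : Prop :=
  ∀ i : VSet lam, i.1 ⊆ w.1 →
    (∀ A B : VSet lam, A.1 ⊆ w.1 → B.1 ⊆ w.1 → unionImage i A = unionImage i B → A = B) →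
    ∀ b : VSet lam, b.1 ⊆ w.1 → ∃ A : VSet lam, A.1 ⊆ w.1 ∧ g (unionImage i A) = b

theorem exists_isJonsson {w : VSet lam} (hw : Set.Infinite {A : VSet lam | A.1 ⊆ w.1}) :
    ∃ g, IsJonsson g w := by
  have := hw.to_subtype
  obtain ⟨F, hF⟩ := exists_forall_surjective_comp
    fun i A : {A : VSet lam | A.1 ⊆ w.1} => unionImage i.1 A.1
  refine ⟨fun z => F z, fun i hi hinj b hb => ?_⟩
  obtain ⟨A, hA⟩ := hF ⟨i, hi⟩ (fun A B h => Subtype.ext (hinj _ _ A.2 B.2 h)) ⟨b, hb⟩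
  exact ⟨A, A.2, congrArg Subtype.val hA⟩

theorem Expressible.isJonsson (hlam : Order.IsSuccLimit lam) {ι α : Type} (i : ι) (a : α) :
    Expressible (graphs (lam := lam)) fun g v => IsJonsson (g i) (v a) :=
  .congr (R' := fun g v => ∀ c : VSet lam, c.1 ⊆ (v a).1 →
      (∀ A B : VSet lam, A.1 ⊆ (v a).1 → B.1 ⊆ (v a).1 →
        (∃ u, unionImage c B = u ∧ unionImage c A = u) → A = B) →
      ∀ b : VSet lam, b.1 ⊆ (v a).1 →
        ∃ A : VSet lam, A.1 ⊆ (v a).1 ∧ ∃ u, unionImage c A = u ∧ g i u = b)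
    (by simp only [IsJonsson, exists_eq_left', implies_true])
    (.all (.imp (.subset _ _) (.imp
      (.all (.all (.imp (.subset _ _) (.imp (.subset _ _)
        (.imp (.ex (.and (.unionImage_eq _ _ _) (.unionImage_eq _ _ _))) (.eq _ _))))))
      (.all (.imp (.subset _ _) (.ex (.and (.subset _ _)
        (.ex (.and (.unionImage_eq _ _ _) (.apply_eq hlam i _ _))))))))))

section Kunen

theorem isSuccLimit_of_cofinal {η : Ordinal.{u}} {s : ℕ → Ordinal.{u}} (hlt : ∀ n, s n < η)
    (hcof : ∀ α < η, ∃ n, α < s n) : Order.IsSuccLimit η := by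
  refine Order.isSuccLimit_iff_of_orderBot.2 ⟨(hlt 0).ne_bot, ?_⟩
  refine Order.isSuccPrelimit_iff_succ_lt.2 fun α hα => ?_
  obtain ⟨n, hn⟩ := hcof α hα
  exact (Order.succ_le_of_lt hn).trans_lt (hlt n)

variable {j : VSet lam ↪ₑ[setLang] VSet lam} (hlam : Order.IsSuccLimit lam)
  (hj : IsSigmaOneZero j) (hne : ∃ x, j x ≠ x)

theorem hasLargestPredecessors_of_mem_iff_critV {K : VSet lam}
    (hK : ∀ x : VSet lam, x.1 ∈ K.1 ↔ ∃ n, x = critV hlam hj hne n) :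
    HasLargestPredecessors K := by
  intro x y hx hy hyx
  obtain ⟨n, rfl⟩ := (hK x).1 hx
  obtain ⟨m, rfl⟩ := (hK y).1 hy
  obtain ⟨n, rfl⟩ := Nat.exists_eq_succ_of_ne_zero
    (Nat.ne_zero_of_lt ((critV_mem_critV_iff hlam hj hne).1 hyx))
  refine ⟨critV hlam hj hne n, (hK _).2 ⟨n, rfl⟩,
    (critV_mem_critV_iff hlam hj hne).2 n.lt_succ_self, fun z hz hzx => ?_⟩
  obtain ⟨k, rfl⟩ := (hK z).1 hz
  rw [critV_mem_critV_iff] at hzx ⊢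
  exact (Nat.lt_succ_iff_lt_or_eq.1 hzx).imp_right (congrArg _)

omit hne in
include hlam hj in
theorem mem_map_cut {A y : VSet lam} {α : Ordinal.{u}} (hα : α < lam) (hy : y.1 ∈ (j A).1)
    (hyα : y.1.rank < α) : y.1 ∈ (j (cut {z | z.1 ∈ A.1} ⟨α, hα⟩)).1 := by
  have hR : Expressible (fun (_ : Unit) (i : Empty) => i.elim) fun _ (v : Fin 3 → VSet lam) =>
      ∀ z : VSet lam, z.1 ∈ (v 0).1 → z.1 ∈ (v 1).1 → z.1 ∈ (v 2).1 :=
    .all (.imp (.mem _ _) (.imp (.mem _ _) (.mem _ _)))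
  refine (hR.map_iff j ![A, levelV α hα, cut {z | z.1 ∈ A.1} ⟨α, hα⟩]).1
    (fun z hzA hzα => mem_cut_iff.2 ⟨(mem_levelV_iff hα).1 hzα, hzA⟩) y hy ?_
  change y.1 ∈ (j (levelV α hα)).1
  rw [map_levelV hlam hj, mem_levelV_iff]
  exact hyα.trans_le (le_onOrd hlam hj hα)

variable {η : Ordinal.{u}} (hη : η < lam) (hlt : ∀ n, critSeq j n < η)
  (hcof : ∀ α < η, ∃ n, α < critSeq j n)
include hlam hj hne hη hlt hcof

theorem onOrd_eq_self_of_critSeq_cofinal : onOrd j η = η := by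
  by_contra hmove
  have hjη : η < onOrd j η := (le_onOrd hlam hj hη).lt_of_ne' hmove
  let κ := critV hlam hj hne
  have hjκ (n : ℕ) : j (κ n) = κ (n + 1) := map_critV hlam hj hne n
  let K : VSet lam := cut (Set.range κ) ⟨η, hη⟩
  have hK (x : VSet lam) : x.1 ∈ K.1 ↔ ∃ n, x = κ n := by
    refine mem_cut_iff.trans ⟨fun ⟨_, n, hn⟩ => ⟨n, hn.symm⟩, ?_⟩
    rintro ⟨n, rfl⟩
    exact ⟨(rank_ordV _).trans_lt (hlt n), n, rfl⟩
  have hunbounded (a : VSet lam) (ha : a.1 ∈ (ordV η hη).1) :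
      ∃ k : VSet lam, k.1 ∈ K.1 ∧ a.1 ⊆ k.1 := by
    obtain ⟨α, hα, ha⟩ := Ordinal.mem_toZFSet_iff.1 ha
    obtain ⟨n, hn⟩ := hcof α hα
    refine ⟨κ n, (hK _).2 ⟨n, rfl⟩, ?_⟩
    rw [← ha]
    exact Ordinal.toZFSet_subset_toZFSet_iff.2 hn.le
  have hjK : HasLargestPredecessors (j K) :=
    ((Expressible.hasLargestPredecessors ()).map_iff j fun _ => K).1
      (hasLargestPredecessors_of_mem_iff_critV hlam hj hne hK)
  have hR : Expressible (fun (_ : Unit) (i : Empty) => i.elim) fun _ (v : Fin 2 → VSet lam) =>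
      ∀ a : VSet lam, a.1 ∈ (v 0).1 → ∃ k : VSet lam, k.1 ∈ (v 1).1 ∧ a.1 ⊆ k.1 :=
    .all (.imp (.mem _ _) (.ex (.and (.mem _ _) (.subset _ _))))
  obtain ⟨k, hkK, hηk⟩ := (hR.map_iff j ![ordV η hη, K]).1 hunbounded (ordV η hη) (by
    simp only [Matrix.cons_val, map_ordV hlam hj]
    exact ordV_mem_ordV_iff.2 hjη)
  obtain ⟨n, hn⟩ := hjK.exists_notMem (s := fun n => κ (n + 1))
    (fun n => by
      rw [← hjκ]
      exact (map_mem_map_iff j).2 ((hK _).2 ⟨n, rfl⟩))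
    (fun n => (critV_mem_critV_iff hlam hj hne).2 (n + 1).lt_succ_self) k hkK
  exact hn (hηk (ordV_mem_ordV_iff.2 (hlt (n + 1))))

theorem unionImage_cut_graphOf {A : VSet lam} (hA : A.1 ⊆ (levelV η hη).1) :
    unionImage (cut (graphOf j) ⟨η, hη⟩) A = j A := by
  have hjη := onOrd_eq_self_of_critSeq_cofinal hlam hj hne hη hlt hcof
  refine VSet.ext_mem fun y => mem_unionImage_iff.trans ⟨?_, fun hy => ?_⟩
  · rintro ⟨c, d, hcA, hcd, hy⟩
    obtain ⟨q, hq, hqi⟩ := pair_mem_iff.1 hcd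
    rw [← (mem_graphOf_iff hq).1 (mem_cut_iff.1 hqi).2] at hy
    exact (map_subset_map_iff j).2 hcA hy
  · have hyη : y.1.rank < η := by
      have h := (map_subset_map_iff j).2 hA hy
      rwa [map_levelV hlam hj, mem_levelV_iff, hjη] at h
    obtain ⟨n, hn⟩ := hcof _ hyη
    have hκ := critSeq_lt hlam hj hne n
    let c : VSet lam := cut {z | z.1 ∈ A.1} ⟨critSeq j n, hκ⟩
    have hcη : c.1.rank < η := (rank_cut_le _ _).trans_lt (hlt n)
    have hjcη : (j c).1.rank < η := by
      rw [rank_map hlam hj, ← hjη]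
      exact onOrd_lt_onOrd hlam hj hcη hη
    have hcA : c.1 ⊆ A.1 := subset_iff_forall.2 fun z hz => (mem_cut_iff.1 hz).2
    have hpair : ZFSet.pair c.1 (j c).1 ∈ V_ η :=
      pair_mem_vonNeumann (isSuccLimit_of_cofinal hlt hcof) (ZFSet.mem_vonNeumann.2 hcη)
        (ZFSet.mem_vonNeumann.2 hjcη)
    have hgraph : (ofMem (levelV η hη) hpair).1 ∈ (cut (graphOf j) ⟨η, hη⟩).1 :=
      mem_cut_iff.2 ⟨ZFSet.mem_vonNeumann.1 hpair, (mem_graphOf_iff rfl).2 rfl⟩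
    exact ⟨c, j c, hcA, hgraph, mem_map_cut hlam hj hκ hy hn⟩

omit hcof in
theorem critSeq_not_cofinal : ¬ ∀ α < η, ∃ n, α < critSeq j n := by
  intro hcof
  let w := levelV η hη
  have hjw : j w = w := by
    rw [map_levelV hlam hj]
    simp only [onOrd_eq_self_of_critSeq_cofinal hlam hj hne hη hlt hcof, w]
  have hsub {x : VSet lam} (hx : x.1.rank ≤ η) : x.1 ⊆ w.1 :=
    ZFSet.subset_vonNeumann.2 hx
  have hinf : Set.Infinite {A : VSet lam | A.1 ⊆ w.1} :=
    Set.infinite_of_injective_forall_mem (f := critV hlam hj hne)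
      (fun _ _ h => (critSeq_strictMono hlam hj hne).injective
        (Ordinal.toZFSet_injective (congrArg Subtype.val h)))
      fun n => hsub ((rank_ordV _).trans_le (hlt n).le)
  obtain ⟨g, hg⟩ := exists_isJonsson hinf
  have hjg : IsJonsson (app j g) w :=
    hjw ▸ (hj.transfer hlam (.isJonsson hlam (0 : Fin 1) (0 : Fin 1)) (fun _ => g) fun _ => w).1 hg
  let i : VSet lam := cut (graphOf j) ⟨η, hη⟩
  have hi {A : VSet lam} (hA : A.1 ⊆ w.1) : unionImage i A = j A :=
    unionImage_cut_graphOf hlam hj hne hη hlt hcof hA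
  obtain ⟨A, hA, hgA⟩ := hjg i (hsub (rank_cut_le _ _))
    (fun A B hA hB h => j.injective ((hi hA).symm.trans (h.trans (hi hB))))
    (critV hlam hj hne 0) (hsub ((rank_ordV _).trans_le (hlt 0).le))
  rw [hi hA, ← hj.map_apply hlam] at hgA
  exact map_ne_crit hlam hj hne _ (congrArg Subtype.val hgA)

omit hη hlt hcof in
theorem exists_lt_critSeq {α : Ordinal.{u}} (hα : α < lam) : ∃ n, α < critSeq j n := by
  by_contra! h
  have hlt (n : ℕ) : critSeq j n < ⨆ n, critSeq j n :=
    (critSeq_strictMono hlam hj hne n.lt_succ_self).trans_le (Ordinal.le_iSup (critSeq j) (n + 1))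
  exact critSeq_not_cofinal hlam hj hne ((Ordinal.iSup_le h).trans_lt hα) hlt
    fun _ => Ordinal.lt_iSup_iff.1

end Kunen

/-! ### Inverse limits -/

/-- The composition `k₀ ∘ k₁ ∘ ⋯ ∘ kₙ₋₁`; thus `compUpTo k n` is `compBelow k (n + 1)`. -/
def compBelow {X : Type*} (k : ℕ → X → X) : ℕ → X → X
  | 0 => id
  | n + 1 => compBelow k n ∘ k n

section CompBelow

variable {X : Type*} {k : ℕ → X → X}

theorem compUpTo_eq_compBelow (n : ℕ) : compUpTo k n = compBelow k (n + 1) := by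
  induction n with
  | zero => rfl
  | succ n ih => rw [compUpTo, ih]; rfl

theorem compBelow_add (n r : ℕ) :
    compBelow k (n + r) = compBelow k n ∘ compBelow (fun i => k (n + i)) r := by
  induction r with
  | zero => rfl
  | succ r ih => rw [← add_assoc, compBelow, ih, compBelow, Function.comp_assoc]

theorem compBelow_eq_self {a : X} (n : ℕ) (h : ∀ i < n, k i a = a) : compBelow k n a = a := by
  induction n with
  | zero => rfl
  | succ n ih =>
    rw [compBelow, Function.comp_apply, h n n.lt_succ_self,
      ih fun i hi => h i (hi.trans n.lt_succ_self)]

theorem exists_inverseLimit_eq {a : X} (h : ∃ n, ∀ m > n, k m a = a) :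
    ∃ N, ∀ M ≥ N, inverseLimit k a = compBelow k M a := by
  classical
  refine ⟨Nat.find h + 1, fun M hM => ?_⟩
  obtain ⟨r, rfl⟩ := Nat.exists_eq_add_of_le hM
  rw [inverseLimit, dif_pos h, compUpTo_eq_compBelow, compBelow_add (Nat.find h + 1),
    Function.comp_apply, compBelow_eq_self r fun i _ => Nat.find_spec h _ (by lia)]

section Commutation

variable (hk : ∀ i m, i ≤ m → ∀ x, k i (k m x) = k (m + 1) (k i x))
include hk

theorem compBelow_comm {n m : ℕ} (hnm : n ≤ m) (x : X) :
    compBelow k n (k m x) = k (m + n) (compBelow k n x) := by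
  induction n generalizing m x with
  | zero => rfl
  | succ n ih =>
    simp only [compBelow, Function.comp_apply]
    rw [hk n m (by lia), ih (by lia), Nat.add_right_comm, add_assoc]

theorem compBelow_compBelow_comm (n r : ℕ) (x : X) :
    compBelow k n (compBelow (fun i => k (n + i)) r x) =
      compBelow (fun i => k (2 * n + i)) r (compBelow k n x) := by
  induction r generalizing x with
  | zero => rfl
  | succ r ih =>
    simp only [compBelow, Function.comp_apply]
    rw [ih, compBelow_comm hk (n.le_add_right r), two_mul, Nat.add_right_comm]

end Commutation

end CompBelow

section Definability

open FirstOrder Language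

variable {L : Language} {M N : Type*} [L.Structure M] [L.Structure N]

theorem exists_coe_eq_compBelow (e : ℕ → M ↪ₑ[L] M) (n : ℕ) :
    ∃ f : M ↪ₑ[L] M, ⇑f = compBelow (fun i => ⇑(e i)) n := by
  induction n with
  | zero => exact ⟨.refl L M, rfl⟩
  | succ n ih =>
    obtain ⟨f, hf⟩ := ih
    exact ⟨f.comp (e n), congrArg (· ∘ e n) hf⟩

theorem mem_range_of_definable₁ (e : N ↪ₑ[L] M) {A : Set M} (hA : A ⊆ Set.range e) {b : M}
    (hb : A.Definable₁ L {b}) : b ∈ Set.range e := by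
  obtain ⟨φ, hφ⟩ := Set.definable_iff_exists_formula_sum.1 hb
  choose q hq using fun a : A => hA a.2
  have hdef (v : Fin 1 → M) : φ.Realize (Sum.elim (e ∘ q) v) ↔ v 0 = b := by
    rw [show e ∘ q = (↑) from funext hq]
    exact (Set.ext_iff.1 hφ v).symm
  have hex : (φ.iExs (Fin 1)).Realize (e ∘ q) :=
    Formula.realize_iExs.2 ⟨fun _ => b, (hdef _).2 rfl⟩
  rw [e.map_formula, Formula.realize_iExs] at hex
  obtain ⟨x, hx⟩ := hex
  rw [← e.map_formula, Sum.comp_elim, hdef] at hx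
  exact ⟨x 0, hx⟩

theorem eventually_mem_range_of_definable₁ {ι : Type*} {l : Filter ι} (e : ι → N ↪ₑ[L] M)
    {A : Set M} (hA : ∀ a ∈ A, ∀ᶠ r in l, a ∈ Set.range (e r)) {b : M}
    (hb : A.Definable₁ L {b}) : ∀ᶠ r in l, b ∈ Set.range (e r) := by
  obtain ⟨A₀, hA₀, hb⟩ := Set.definable_iff_finitely_definable.1 hb
  have h : ∀ᶠ r in l, ∀ a ∈ A₀, a ∈ Set.range (e r) :=
    (Filter.eventually_all_finset A₀).2 fun a ha => hA a (hA₀ ha)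
  exact h.mono fun r hr => mem_range_of_definable₁ (e r) hr hb

end Definability

section RightPowers

variable {j : VSet lam ↪ₑ[setLang] VSet lam} (hlam : Order.IsSuccLimit lam)
  (hj : IsSigmaOneZero j) (hne : ∃ x, j x ≠ x)
include hlam hj hne

theorem exists_forall_rightPower_eq_self (a : VSet lam) :
    ∃ N, ∀ m > N, rightPower j m a = a := by
  obtain ⟨N, hN⟩ := exists_lt_critSeq hlam hj hne (rank_lt a)
  exact ⟨N, fun m hm =>
    rightPower_eq_self hlam hj hne (hN.trans (critSeq_strictMono hlam hj hne hm))⟩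

theorem compBelow_rightPower_critV (n r : ℕ) :
    compBelow (fun i => rightPower j (n + i)) (r + 1) (critV hlam hj hne n) =
      critV hlam hj hne (n + 1) := by
  induction r with
  | zero => exact rightPower_critV hlam hj hne n
  | succ r ih =>
    rw [compBelow, Function.comp_apply, rightPower_eq_self hlam hj hne, ih]
    exact (rank_ordV _).trans_lt (critSeq_strictMono hlam hj hne (by lia))

theorem compBelow_rightPower_eq_self {n : ℕ} (r : ℕ) {x : VSet lam}
    (hx : x.1.rank < critSeq j n) : compBelow (fun i => rightPower j (n + i)) r x = x :=
  compBelow_eq_self r fun i _ => rightPower_eq_self hlam hj hne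
    (hx.trans_le ((critSeq_strictMono hlam hj hne).monotone (n.le_add_right i)))

omit hne in
theorem exists_coe_eq_compBelow_rightPower (n r : ℕ) :
    ∃ e : VSet lam ↪ₑ[setLang] VSet lam, ⇑e = compBelow (fun i => rightPower j (n + i)) r := by
  simp only [← coe_rightPowerEmbedding hlam hj]
  exact exists_coe_eq_compBelow _ r

theorem compBelow_rightPower_notMem_ordInterval (n r : ℕ) (x : VSet lam) :
    compBelow (fun i => rightPower j (n + i)) (r + 1) x ∉
      ordInterval lam (critSeq j n) (critSeq j (n + 1)) := by
  rintro ⟨γ, hγ, hγ', hxγ⟩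
  have hmem : x.1 ∈ (critV hlam hj hne n).1 := by
    obtain ⟨e, he⟩ := exists_coe_eq_compBelow_rightPower hlam hj n (r + 1)
    rw [← map_mem_map_iff e, he, compBelow_rightPower_critV, hxγ]
    exact Ordinal.toZFSet_mem_toZFSet_iff.2 hγ'
  have hrank : x.1.rank < critSeq j n := (ZFSet.rank_lt_of_mem hmem).trans_eq (rank_ordV _)
  rw [compBelow_rightPower_eq_self hlam hj hne _ hrank] at hxγ
  rw [hxγ, Ordinal.rank_toZFSet] at hrank
  exact hγ.not_gt hrank

theorem eventually_mem_range_compBelow_rightPower (n : ℕ) {a : VSet lam}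
    (ha : a ∈ Set.range (inverseLimit (rightPower j)) ∪ levelSet lam (critSeq j (2 * n))) :
    ∀ᶠ r in Filter.atTop, a ∈ Set.range (compBelow (fun i => rightPower j (2 * n + i)) r) := by
  obtain ⟨c, rfl⟩ | ha := ha
  · obtain ⟨N, hN⟩ := exists_inverseLimit_eq (exists_forall_rightPower_eq_self hlam hj hne c)
    refine Filter.eventually_atTop.2 ⟨N, fun r hr => ⟨compBelow (rightPower j) n c, ?_⟩⟩
    rw [hN (n + r) (by lia), compBelow_add, Function.comp_apply]
    exact (compBelow_compBelow_comm (k := rightPower j)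
      (fun _ _ him => rightPower_rightPower_apply hlam hj him) n r c).symm
  · exact .of_forall fun r =>
      ⟨a, compBelow_rightPower_eq_self hlam hj hne r (ZFSet.mem_vonNeumann.1 ha)⟩

theorem ordInterval_inter_defClosure (n : ℕ) :
    ordInterval lam (critSeq j (2 * n)) (critSeq j (2 * n + 1)) ∩
      defClosure (Set.range (inverseLimit (rightPower j)) ∪ levelSet lam (critSeq j (2 * n))) =
        ∅ := by
  rw [Set.eq_empty_iff_forall_notMem]
  rintro b ⟨hb, hdef⟩
  choose e he using exists_coe_eq_compBelow_rightPower hlam hj (2 * n)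
  have hrange : ∀ᶠ r in Filter.atTop, b ∈ Set.range (e r) :=
    eventually_mem_range_of_definable₁ e
      (fun a ha => by simpa only [he] using
        eventually_mem_range_compBelow_rightPower hlam hj hne n ha) hdef
  obtain ⟨r, hr⟩ := Filter.eventually_atTop.1 hrange
  obtain ⟨x, rfl⟩ := hr (r + 1) r.le_succ
  rw [he] at hb
  exact compBelow_rightPower_notMem_ordInterval hlam hj hne _ r x hb

end RightPowers

theorem proposition19_general (hlam : Order.IsSuccLimit lam) (j : VSet lam ↪ₑ[setLang] VSet lam)
    (hne : ∃ x, j x ≠ x) (hj : IsSigmaOneZero j) :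
    (StrictMono (critSeq j) ∧ ∀ n, critSeq j n < lam) ∧
    (∀ n, graphOf (rightPower j (n + 1)) =
      extend (rightPower j n) (graphOf (rightPower j n))) ∧
    (∀ a, ∃ N, ∀ m > N, rightPower j m a = a) ∧
    ∀ n : ℕ, ordInterval lam (critSeq j (2 * n)) (critSeq j (2 * n + 1)) ∩
      defClosure (Set.range (inverseLimit (rightPower j)) ∪ levelSet lam (critSeq j (2 * n))) =
        ∅ :=
  ⟨⟨critSeq_strictMono hlam hj hne, critSeq_lt hlam hj hne⟩, graphOf_rightPower_succ hlam hj,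
    exists_forall_rightPower_eq_self hlam hj hne, ordInterval_inter_defClosure hlam hj hne⟩

end RankToRank

/-- The first three conjuncts say that the objects in the claim are well defined: the critical
sequence exists and increases strictly below `λ`, each right power is the function whose graph
is obtained by applying the previous one to itself, and the inverse limit of the right powers is
defined on all of `V_λ`. The fourth one is the claim. -/
theorem proposition19 (lam : Ordinal.{u}) (hlam : Order.IsSuccLimit lam)
    (j : RankToRank.VSet lam ↪ₑ[RankToRank.setLang] RankToRank.VSet lam)
    (hne : ∃ x, j x ≠ x) (hj : RankToRank.IsSigmaOneOne j) :
    (StrictMono (RankToRank.critSeq j) ∧ ∀ n, RankToRank.critSeq j n < lam) ∧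
    (∀ n, RankToRank.graphOf (RankToRank.rightPower j (n + 1)) =
      RankToRank.extend (RankToRank.rightPower j n)
        (RankToRank.graphOf (RankToRank.rightPower j n))) ∧
    (∀ a, ∃ N, ∀ m > N, RankToRank.rightPower j m a = a) ∧
    ∀ n : ℕ,
      RankToRank.ordInterval lam (RankToRank.critSeq j (2 * n))
          (RankToRank.critSeq j (2 * n + 1)) ∩
        RankToRank.defClosure
          (Set.range (RankToRank.inverseLimit (RankToRank.rightPower j)) ∪
            RankToRank.levelSet lam (RankToRank.critSeq j (2 * n))) = ∅ := by
  exact RankToRank.proposition19_general hlam j hne hj.isSigmaOneZero
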